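/- For $n\ge 1$ and $\delta\in(0,n]$, the $\delta$-dimensional Hausdorff content of a set $E\subset\mathbb{R}^n$ is $$\mathcal{H}^\delta_\infty(E)=\inf\Big\{\sum_i r_i^\delta : E\subset\bigcup_i B(x_i,r_i)\Big\},$$ the infimum being taken over all countable (or finite) families of open balls covering $E$. For any function $g:\mathbb{R}^n\to[0,\infty]$, the Choquet integral of $g$ is $$\int_{\mathbb{R}^n} g\,d\mathcal{H}^\delta_\infty=\int_0^\infty \mathcal{H}^\delta_\infty(\{x\in\mathbb{R}^n: g(x)>t\})\,dt .$$ For $\alpha\in(0,\delta)$ and $f:\mathbb{R}^n\to[-\infty,\infty]$, the Hausdorff content Riesz potential of $f$ is $$\mathcal{R}^\delta_\alpha f(x)=\int_{\mathbb{R}^n}\frac{|f(y)|}{|x-y|^{\delta-\alpha}}\,d\mathcal{H}^\delta_\infty(y),\qquad x\in\mathbb{R}^n .$$ **Theorem.** Let $n\ge 1$, $\delta\in(0,n)$, $\alpha\in(0,\delta)$ and $p\in(1,\delta/\alpha)$. There is a finite constant $c$, depending only on $n,\delta,\alpha$ and $p$, such that for all Lebesgue measurable functions $f:\mathbb{R}^n\to[-\infty,\infty]$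 $$\bigg(\int_{\mathbb{R}^n}\big(\mathcal{R}^\delta_\alpha f(x)\big)^{\frac{\delta p}{\delta-p\alpha}}\,d\mathcal{H}^\delta_\infty\bigg)^{\frac{\delta-p\alpha}{\delta p}}\le c\,\bigg(\int_{\mathbb{R}^n}|f(x)|^p\,d\mathcal{H}^\delta_\infty\bigg)^{\frac1p}.$$ (Both sides take values in $[0,\infty]$.) -/

import Mathlib

open MeasureTheory Set
open scoped NNReal ENNReal

/-- The `δ`-dimensional Hausdorff content of a subset `E` of `ℝⁿ`: the infimum of `∑ rᵢ ^ δ` over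
all countable or finite families of open balls `B(xᵢ, rᵢ)` covering `E`. A ball of radius `0` is
empty and contributes `0 ^ δ = 0` when `0 < δ`, so finite families are included. -/
noncomputable def hausdorffContent {n : ℕ} (δ : ℝ) (E : Set (EuclideanSpace ℝ (Fin n))) : ℝ≥0∞ :=
  ⨅ (x : ℕ → EuclideanSpace ℝ (Fin n)) (r : ℕ → ℝ≥0)
    (_ : E ⊆ ⋃ i, Metric.ball (x i) (r i)), ∑' i, (r i : ℝ≥0∞) ^ δ

/-- The Choquet integral `∫ g dH = ∫_0^∞ H {x | g x > t} dt` of an arbitrary function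
`g : X → [0, ∞]` with respect to a set function `H`. -/
noncomputable def choquetIntegral {X : Type*} (H : Set X → ℝ≥0∞) (g : X → ℝ≥0∞) : ℝ≥0∞ :=
  ∫⁻ t in Ioi (0 : ℝ), H {x | ENNReal.ofReal t < g x}

/-- The Hausdorff content Riesz potential
`R f (x) = ∫ |f y| / |x - y| ^ (δ - α) dH(y)`, a Choquet integral with respect to the
`δ`-dimensional Hausdorff content. For `0 < δ` the integrand's value at the single point `y = x`
does not matter, because points have content zero. -/
noncomputable def hausdorffRieszPotential {n : ℕ} (δ α : ℝ)
    (f : EuclideanSpace ℝ (Fin n) → EReal) (x : EuclideanSpace ℝ (Fin n)) : ℝ≥0∞ :=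
  choquetIntegral (hausdorffContent δ) fun y => (f y).abs / ‖x - y‖ₑ ^ (δ - α)

/-!
The proof follows Hedberg: the potential is bounded pointwise by means over balls, and these by a
maximal inequality. The content is not additive on disjoint balls, which breaks the usual
covering proof of the latter, and sublinearity of its Choquet integral is avoided. The argument
uses only that the content `H` is an outer measure defined through covers by balls; in particular no
measurability of the functions enters.

*Maximal inequality.* The weak type bound is needed for sets only: the points `x` with
`H (E ∩ ball x r) > s r ^ δ` for some `r` have content at most a multiple of `H E / s`
(`hausdorffContent_setOf_lt_inter_ball_le`). If balls `B (zᵢ, ρᵢ)` cover `E`, then either `x` is in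
a double of one of them, or the balls that meet `ball x r` have radius at most `r`, so that the
discrete measure `∑ ρᵢ ^ δ • dirac zᵢ` has mass more than `s r ^ δ` in `closedBall x (2 r)`. That
measure is additive, so the Vitali covering lemma applies to it.
For a function `g` and `1 < q < p`, a point around which every layer `{g > 2 ^ k s}` has
density at most `2 ^ (-k q)` at all scales sees only means of `g` bounded by a multiple of `s`.
Hence the points where some mean is larger are covered by countably many sets of the above kind
(`hausdorffContent_setOf_lt_choquetIntegral_le`).

*Potential.* The superlevel sets of `g y / |x - y| ^ (δ - α)` split over the dyadic annuli around
`x`, so countable subadditivity bounds the potential by a sum of Choquet integrals of `g` over balls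
(`choquetIntegral_div_rpow_le_tsum`). The small balls are controlled by the maximal inequality,
the large ones by Hölder's inequality (`choquetIntegral_inter_ball_le`). Choosing the
radius between the two as a function of the level bounds the distribution function of the
potential by dilates of the distribution function of `g ^ p`, and integrating over the level gives
a geometric series with ratio `2 ^ (q - p)`.
-/

/-! ### The Hausdorff content as an outer measure -/

theorem hausdorffContent_le_tsum {n : ℕ} {δ : ℝ} {E : Set (EuclideanSpace ℝ (Fin n))}
    (x : ℕ → EuclideanSpace ℝ (Fin n)) (r : ℕ → ℝ≥0) (h : E ⊆ ⋃ i, Metric.ball (x i) (r i)) :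
    hausdorffContent δ E ≤ ∑' i, (r i : ℝ≥0∞) ^ δ :=
  iInf_le_of_le x (iInf_le_of_le r (iInf_le _ h))

theorem hausdorffContent_mono {n : ℕ} {δ : ℝ} {E F : Set (EuclideanSpace ℝ (Fin n))}
    (h : E ⊆ F) : hausdorffContent δ E ≤ hausdorffContent δ F :=
  le_iInf fun x => le_iInf fun r => le_iInf fun hF => hausdorffContent_le_tsum x r (h.trans hF)

theorem hausdorffContent_ball_le {n : ℕ} {δ : ℝ} (hδ : 0 < δ) (x : EuclideanSpace ℝ (Fin n))
    {r : ℝ} (hr : 0 ≤ r) : hausdorffContent δ (Metric.ball x r) ≤ ENNReal.ofReal (r ^ δ) := by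
  refine (hausdorffContent_le_tsum (fun _ => x) (fun i => if i = 0 then r.toNNReal else 0)
    fun y hy => mem_iUnion.2 ⟨0, by simpa [hr] using hy⟩).trans ?_
  rw [tsum_eq_single 0 (fun i hi => by simp [hi, hδ])]
  rw [← ENNReal.ofReal_rpow_of_nonneg hr hδ.le]
  simp [ENNReal.ofReal]

theorem hausdorffContent_iUnion_le {n : ℕ} {δ : ℝ} (s : ℕ → Set (EuclideanSpace ℝ (Fin n))) :
    hausdorffContent δ (⋃ i, s i) ≤ ∑' i, hausdorffContent δ (s i) := by
  refine ENNReal.le_of_forall_pos_le_add fun ε hε hfin => ?_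
  obtain ⟨ε', hε', hsum⟩ := ENNReal.exists_pos_sum_of_countable
    (ENNReal.coe_ne_zero.2 hε.ne') ℕ
  have hlt (i : ℕ) : hausdorffContent δ (s i) < hausdorffContent δ (s i) + ε' i :=
    ENNReal.lt_add_right ((ENNReal.le_tsum i).trans_lt hfin).ne (by simpa using (hε' i).ne')
  have hex (i : ℕ) : ∃ (x : ℕ → EuclideanSpace ℝ (Fin n)) (r : ℕ → ℝ≥0),
      (s i ⊆ ⋃ j, Metric.ball (x j) (r j)) ∧
        ∑' j, (r j : ℝ≥0∞) ^ δ < hausdorffContent δ (s i) + ε' i := by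
    have := hlt i
    conv_lhs at this => unfold hausdorffContent
    simpa only [iInf_lt_iff, exists_prop] using this
  choose x r hcov hlt' using hex
  calc hausdorffContent δ (⋃ i, s i)
      ≤ ∑' m : ℕ, (r m.unpair.1 m.unpair.2 : ℝ≥0∞) ^ δ := by
        refine hausdorffContent_le_tsum (fun m => x m.unpair.1 m.unpair.2)
          (fun m => r m.unpair.1 m.unpair.2) (iUnion_subset fun i y hy => ?_)
        obtain ⟨j, hj⟩ := mem_iUnion.1 (hcov i hy)
        exact mem_iUnion.2 ⟨Nat.pair i j, by simpa using hj⟩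
    _ = ∑' i, ∑' j, (r i j : ℝ≥0∞) ^ δ := by
        rw [← ENNReal.tsum_prod (f := fun i j => (r i j : ℝ≥0∞) ^ δ)]
        exact Nat.pairEquiv.symm.tsum_eq (fun q : ℕ × ℕ => (r q.1 q.2 : ℝ≥0∞) ^ δ)
    _ ≤ ∑' i, (hausdorffContent δ (s i) + ε' i) := ENNReal.tsum_le_tsum fun i => (hlt' i).le
    _ ≤ ∑' i, hausdorffContent δ (s i) + ε := by
        rw [ENNReal.tsum_add]; gcongr

/-- The Hausdorff content of positive dimension, bundled as an outer measure. -/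
noncomputable def hausdorffContentOuter (n : ℕ) {δ : ℝ} (hδ : 0 < δ) :
    OuterMeasure (EuclideanSpace ℝ (Fin n)) where
  measureOf := hausdorffContent δ
  empty := le_antisymm ((hausdorffContent_mono (empty_subset (Metric.ball 0 0))).trans
    ((hausdorffContent_ball_le hδ 0 le_rfl).trans (by simp [hδ.ne']))) bot_le
  mono := hausdorffContent_mono
  iUnion_nat s _ := hausdorffContent_iUnion_le s

theorem hausdorffContentOuter_apply {n : ℕ} {δ : ℝ} (hδ : 0 < δ)
    (E : Set (EuclideanSpace ℝ (Fin n))) :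
    hausdorffContentOuter n hδ E = hausdorffContent δ E := rfl

theorem hausdorffContent_singleton {n : ℕ} {δ : ℝ} (hδ : 0 < δ) (x : EuclideanSpace ℝ (Fin n)) :
    hausdorffContent δ {x} = 0 := by
  refine le_antisymm (ENNReal.le_of_forall_pos_le_add fun ε hε _ => ?_) bot_le
  have h0 : (0 : ℝ) < (ε : ℝ) ^ δ⁻¹ := Real.rpow_pos_of_pos hε _
  refine (hausdorffContent_mono (F := Metric.ball x ((ε : ℝ) ^ δ⁻¹)) (by simpa using h0)).trans
    ((hausdorffContent_ball_le hδ x h0.le).trans ?_)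
  rw [← Real.rpow_mul ε.coe_nonneg, inv_mul_cancel₀ hδ.ne', Real.rpow_one, zero_add,
    ENNReal.ofReal_coe_nnreal]

/-! ### The weak type maximal inequality for sets -/

/-- The Vitali covering argument: for a finite measure `μ`, the points around which `μ` has density
more than `s` at some scale form a set of content at most a multiple of `μ univ / s`. -/
theorem hausdorffContent_setOf_lt_measure_closedBall_le {n : ℕ} {δ : ℝ} (hδ : 0 < δ)
    (μ : Measure (EuclideanSpace ℝ (Fin n))) [IsFiniteMeasure μ] {s : ℝ} (hs : 0 < s) :
    hausdorffContent δ
        {x | ∃ r : ℝ, 0 < r ∧ ENNReal.ofReal (s * r ^ δ) < μ (Metric.closedBall x (2 * r))} ≤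
      ENNReal.ofReal (11 ^ δ / s) * μ univ := by
  set V := {x | ∃ r : ℝ, 0 < r ∧ ENNReal.ofReal (s * r ^ δ) < μ (Metric.closedBall x (2 * r))}
    with hV
  choose! r hr0 hr using fun x (hx : x ∈ V) => hx
  -- The radii are bounded, because `μ` is finite.
  have hbound : ∀ x ∈ V, 2 * r x ≤ 2 * ((μ univ).toReal / s) ^ δ⁻¹ := fun x hx => by
    have h1 := (hr x hx).le.trans (measure_mono (subset_univ _))
    rw [ENNReal.ofReal_le_iff_le_toReal (measure_ne_top _ _)] at h1
    have h2 : r x ^ δ ≤ (μ univ).toReal / s := by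
      rw [le_div_iff₀ hs]; linarith
    gcongr
    exact (Real.le_rpow_inv_iff_of_pos (hr0 x hx).le (by positivity) hδ).2 h2
  obtain ⟨u, huV, hdisj, hcov⟩ := Vitali.exists_disjoint_subfamily_covering_enlargement_closedBall
    V id (fun x => 2 * r x) _ hbound 5 (by norm_num)
  simp only [id] at hdisj hcov
  have hcount : u.Countable := hdisj.countable_of_nonempty_interior fun x hx =>
    ⟨x, Metric.ball_subset_interior_closedBall
      (Metric.mem_ball_self (by linarith [hr0 x (huV hx)]))⟩
  have : Countable u := hcount.to_subtype
  have hsub : V ⊆ ⋃ y : u, Metric.ball (y : EuclideanSpace ℝ (Fin n)) (11 * r y) := fun x hx => by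
    obtain ⟨y, hy, hxy⟩ := hcov x hx
    refine mem_iUnion.2 ⟨⟨y, hy⟩, ?_⟩
    refine Metric.closedBall_subset_ball ?_
      (hxy (Metric.mem_closedBall_self (by linarith [hr0 x hx])))
    linarith [hr0 y (huV hy)]
  calc hausdorffContent δ V
      ≤ ∑' y : u, hausdorffContent δ (Metric.ball (y : EuclideanSpace ℝ (Fin n)) (11 * r y)) :=
        (hausdorffContent_mono hsub).trans (measure_iUnion_le (μ := hausdorffContentOuter n hδ) _)
    _ ≤ ∑' y : u, ENNReal.ofReal (11 ^ δ / s) * μ (Metric.closedBall y (2 * r y)) := by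
        refine ENNReal.tsum_le_tsum fun y => ?_
        have h0 := hr0 y (huV y.2)
        refine (hausdorffContent_ball_le hδ _ (by positivity)).trans ?_
        rw [show ((11 : ℝ) * r y) ^ δ = 11 ^ δ / s * (s * r y ^ δ) by
          rw [Real.mul_rpow (by norm_num) h0.le]; field_simp,
          ENNReal.ofReal_mul (by positivity)]
        gcongr
        exact (hr y (huV y.2)).le
    _ ≤ ENNReal.ofReal (11 ^ δ / s) * μ univ := by
        rw [ENNReal.tsum_mul_left]
        gcongr
        refine (tsum_meas_le_meas_iUnion_of_disjoint μ
          (fun y : u => Metric.isClosed_closedBall.measurableSet) ?_).trans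
          (measure_mono (subset_univ _))
        exact fun a b hab => hdisj a.2 b.2 (fun h => hab (Subtype.ext h))

/-- The weak type bound of the maximal operator of the content on indicator functions. The content
of `E` is traded for the measure carrying the mass `rᵢ ^ δ` at the centre of each ball of a cover
of `E`. Being additive, that measure admits the Vitali covering argument, whereas the content
does not. -/
theorem hausdorffContent_setOf_lt_inter_ball_le {n : ℕ} {δ : ℝ} (hδ : 0 < δ)
    (E : Set (EuclideanSpace ℝ (Fin n))) {s : ℝ} (hs : 0 < s) (hs1 : s ≤ 1) :
    hausdorffContent δ
        {x | ∃ r : ℝ, 0 < r ∧ ENNReal.ofReal (s * r ^ δ) < hausdorffContent δ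
          (E ∩ Metric.ball x r)} ≤
      ENNReal.ofReal (2 * 11 ^ δ / s) * hausdorffContent δ E := by
  classical
  have hC : 0 < 2 * 11 ^ δ / s := by positivity
  rw [mul_comm, ← ENNReal.div_le_iff_le_mul (by simp [hC]) (by simp)]
  refine le_iInf fun z => le_iInf fun ρ => le_iInf fun hE => ?_
  rw [ENNReal.div_le_iff_le_mul (by simp [hC]) (by simp), mul_comm]
  set S := ∑' i, (ρ i : ℝ≥0∞) ^ δ with hS
  rcases eq_or_ne S ∞ with htop | htop
  · rw [htop, ENNReal.mul_top (by simp [hC])]; exact le_top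
  let μ : Measure (EuclideanSpace ℝ (Fin n)) :=
    Measure.sum fun i => ((ρ i : ℝ≥0∞) ^ δ) • Measure.dirac (z i)
  have hμu : μ univ = S := by simp [μ, hS]
  have : IsFiniteMeasure μ := ⟨by rw [hμu]; exact htop.lt_top⟩
  have hsub : {x | ∃ r : ℝ, 0 < r ∧ ENNReal.ofReal (s * r ^ δ) < hausdorffContent δ
          (E ∩ Metric.ball x r)} ⊆
      (⋃ i, Metric.ball (z i) (2 * ρ i)) ∪
      {x | ∃ r : ℝ, 0 < r ∧ ENNReal.ofReal (s * r ^ δ) < μ (Metric.closedBall x (2 * r))} := by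
    rintro x ⟨r, hr, hlt⟩
    by_cases hx : x ∈ ⋃ i, Metric.ball (z i) (2 * ρ i)
    · exact Or.inl hx
    refine Or.inr ⟨r, hr, hlt.trans_le ?_⟩
    -- Every ball of the cover that meets `ball x r` has radius at most `r`.
    have hmeet : E ∩ Metric.ball x r ⊆
        ⋃ i, if z i ∈ Metric.closedBall x (2 * r) then Metric.ball (z i) (ρ i) else ∅ := by
      rintro y ⟨hyE, hyx⟩
      obtain ⟨i, hi⟩ := mem_iUnion.1 (hE hyE)
      refine mem_iUnion.2 ⟨i, ?_⟩
      have h1 : (2 * ρ i : ℝ) ≤ dist x (z i) := by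
        by_contra hcon
        exact hx (mem_iUnion.2 ⟨i, not_le.1 hcon⟩)
      rw [Metric.mem_ball] at hi hyx
      have h2 := dist_triangle x y (z i)
      rw [dist_comm x y] at h2
      rw [if_pos (by rw [Metric.mem_closedBall, dist_comm]; linarith)]
      exact hi
    refine (hausdorffContent_mono hmeet).trans
      ((measure_iUnion_le (μ := hausdorffContentOuter n hδ) _).trans ?_)
    rw [Measure.sum_apply _ Metric.isClosed_closedBall.measurableSet]
    refine ENNReal.tsum_le_tsum fun i => ?_
    split_ifs with h
    · refine (hausdorffContent_ball_le hδ _ (ρ i).coe_nonneg).trans (le_of_eq ?_)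
      rw [Measure.smul_apply, Measure.dirac_apply' _ Metric.isClosed_closedBall.measurableSet]
      simp [h, ← ENNReal.ofReal_rpow_of_nonneg (ρ i).coe_nonneg hδ.le]
    · simp
  have hbig : hausdorffContent δ (⋃ i, Metric.ball (z i) (2 * ρ i)) ≤
      ENNReal.ofReal (11 ^ δ / s) * S := by
    refine (hausdorffContent_iUnion_le _).trans ?_
    rw [hS, ← ENNReal.tsum_mul_left]
    refine ENNReal.tsum_le_tsum fun i => (hausdorffContent_ball_le hδ _ (by positivity)).trans ?_
    rw [Real.mul_rpow (by norm_num) (ρ i).coe_nonneg, ENNReal.ofReal_mul (by positivity),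
      ← ENNReal.ofReal_rpow_of_nonneg (ρ i).coe_nonneg hδ.le, ENNReal.ofReal_coe_nnreal]
    gcongr
    rw [le_div_iff₀ hs]
    calc (2 : ℝ) ^ δ * s ≤ 2 ^ δ * 1 := by gcongr
      _ ≤ 11 ^ δ := by rw [mul_one]; gcongr; norm_num
  calc _ ≤ ENNReal.ofReal (11 ^ δ / s) * S + ENNReal.ofReal (11 ^ δ / s) * S := by
        refine (hausdorffContent_mono hsub).trans
          ((measure_union_le (μ := hausdorffContentOuter n hδ) _ _).trans
            (add_le_add hbig ?_))
        rw [← hμu]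
        exact hausdorffContent_setOf_lt_measure_closedBall_le hδ μ hs
    _ = ENNReal.ofReal (2 * 11 ^ δ / s) * S := by
        rw [← add_mul, ← ENNReal.ofReal_add (by positivity) (by positivity)]
        congr 2; ring

/-! ### Integrals of distribution functions -/

theorem ENNReal.tsum_ofReal_mul_geometric {a b : ℝ} (ha : 0 ≤ a) (hb : 0 ≤ b) (hb1 : b < 1) :
    ∑' k : ℕ, ENNReal.ofReal (a * b ^ k) = ENNReal.ofReal (a * (1 - b)⁻¹) := by
  rw [← ENNReal.ofReal_tsum_of_nonneg (fun k => by positivity)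
    ((summable_geometric_of_lt_one hb hb1).mul_left a), tsum_mul_left,
    tsum_geometric_of_lt_one hb hb1]

theorem lintegral_Ioi_comp_mul_left (φ : ℝ → ℝ≥0∞) {c : ℝ} (hc : 0 < c) :
    ∫⁻ t in Ioi (0 : ℝ), φ (c * t) = ENNReal.ofReal c⁻¹ * ∫⁻ t in Ioi (0 : ℝ), φ t := by
  have h : ∀ t, (Ioi (0 : ℝ)).indicator (fun t => φ (c * t)) t =
      (Ioi (0 : ℝ)).indicator φ (c * t) := fun t => by
    simp [indicator, hc]
  rw [← lintegral_indicator measurableSet_Ioi, ← lintegral_indicator measurableSet_Ioi]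
  simp_rw [h]
  rw [show (fun t => (Ioi (0 : ℝ)).indicator φ (c * t)) =
    fun t => (Ioi (0 : ℝ)).indicator φ (MeasurableEquiv.mulLeft₀ c hc.ne' t) from rfl,
    ← lintegral_map_equiv, MeasurableEquiv.coe_mulLeft₀, Real.map_volume_mul_left hc.ne',
    lintegral_smul_measure, abs_of_pos (inv_pos.2 hc), smul_eq_mul]

/-- Dyadic comparison for a nonincreasing function. -/
theorem Antitone.lintegral_Ioi_le_tsum {φ : ℝ → ℝ≥0∞} (hφ : Antitone φ) {s : ℝ} (hs : 0 < s) :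
    ∫⁻ t in Ioi s, φ t ≤ ∑' k : ℕ, ENNReal.ofReal (2 ^ k * s) * φ (2 ^ k * s) := by
  have hsub : Ioi s ⊆ ⋃ k : ℕ, Ico (2 ^ k * s) (2 ^ (k + 1) * s) := fun t ht => by
    obtain ⟨k, h1, h2⟩ := exists_nat_pow_near ((one_le_div hs).2 (le_of_lt ht)) one_lt_two
    exact mem_iUnion.2 ⟨k, (le_div_iff₀ hs).1 h1, (div_lt_iff₀ hs).1 h2⟩
  refine (lintegral_mono_set hsub).trans ((lintegral_iUnion_le _ _).trans
    (ENNReal.tsum_le_tsum fun k => ?_))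
  calc ∫⁻ t in Ico (2 ^ k * s) (2 ^ (k + 1) * s), φ t
      ≤ ∫⁻ _ in Ico (2 ^ k * s) (2 ^ (k + 1) * s), φ (2 ^ k * s) :=
        setLIntegral_mono' measurableSet_Ico fun t ht => hφ ht.1
    _ = _ := by
        rw [setLIntegral_const, Real.volume_Ico, mul_comm]
        congr 2; ring

theorem antitone_superlevel {X : Type*} (g : X → ℝ≥0∞) :
    Antitone fun t : ℝ => {y | ENNReal.ofReal t < g y} :=
  fun _ _ hab _ hy => (ENNReal.ofReal_le_ofReal hab).trans_lt hy

theorem antitone_outerMeasure_superlevel {X : Type*} (H : OuterMeasure X) (g : X → ℝ≥0∞) :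
    Antitone fun t : ℝ => H {y | ENNReal.ofReal t < g y} :=
  fun _ _ hab => H.mono (antitone_superlevel g hab)

theorem antitone_outerMeasure_superlevel_inter {X : Type*} (H : OuterMeasure X) (g : X → ℝ≥0∞)
    (B : Set X) : Antitone fun t : ℝ => H ({y | ENNReal.ofReal t < g y} ∩ B) :=
  fun _ _ hab => H.mono (inter_subset_inter_left B (antitone_superlevel g hab))

/-- Chebyshev's inequality for the Choquet integral. -/
theorem outerMeasure_superlevel_le_of_choquetIntegral_rpow_le {X : Type*} (H : OuterMeasure X)
    {g : X → ℝ≥0∞} {p A t : ℝ} (hp : 0 < p) (ht : 0 < t)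
    (hA : choquetIntegral H (fun y => g y ^ p) ≤ ENNReal.ofReal A) :
    H {y | ENNReal.ofReal t < g y} ≤ ENNReal.ofReal (A / t ^ p) := by
  have htp : 0 < t ^ p := Real.rpow_pos_of_pos ht p
  rw [ENNReal.ofReal_div_of_pos htp, ENNReal.le_div_iff_mul_le (by simp [htp]) (by simp)]
  calc H {y | ENNReal.ofReal t < g y} * ENNReal.ofReal (t ^ p)
      = ∫⁻ _ in Ioc 0 (t ^ p), H {y | ENNReal.ofReal t < g y} := by
        rw [setLIntegral_const, Real.volume_Ioc, sub_zero]
    _ ≤ ∫⁻ u in Ioc 0 (t ^ p), H {y | ENNReal.ofReal u < g y ^ p} := by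
        refine setLIntegral_mono' measurableSet_Ioc fun u hu => H.mono fun y hy => ?_
        refine (ENNReal.ofReal_le_ofReal hu.2).trans_lt ?_
        rw [← ENNReal.ofReal_rpow_of_nonneg ht.le hp.le]
        exact ENNReal.rpow_lt_rpow hy hp
    _ ≤ choquetIntegral H (fun y => g y ^ p) := lintegral_mono_set Ioc_subset_Ioi_self
    _ ≤ ENNReal.ofReal A := hA

theorem two_rpow_one_sub_lt_one {q : ℝ} (hq : 1 < q) : (2 : ℝ) ^ (1 - q) < 1 :=
  Real.rpow_lt_one_of_one_lt_of_neg one_lt_two (by linarith)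

/-- The sum of the layers, `1 + ∑ₖ 2 ^ k * 2 ^ (-k q)`, of a function whose
distribution decays like the power `q > 1`. -/
noncomputable def layerConst (q : ℝ) : ℝ := 1 + (1 - 2 ^ (1 - q))⁻¹

theorem layerConst_pos {q : ℝ} (hq : 1 < q) : 0 < layerConst q := by
  have := two_rpow_one_sub_lt_one hq
  have : 0 < (1 - (2 : ℝ) ^ (1 - q))⁻¹ := inv_pos.2 (by linarith)
  unfold layerConst; positivity

/-- A function whose superlevel sets in `B` decay like the power `q > 1` beyond the level `s` has
a Choquet integral over `B` comparable to that of the constant `s`. -/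
theorem choquetIntegral_inter_le_of_decay {X : Type*} (H : OuterMeasure X) (g : X → ℝ≥0∞)
    {B : Set X} {q s m : ℝ} (hq : 1 < q) (hs : 0 < s) (hm : 0 ≤ m) (hB : H B ≤ ENNReal.ofReal m)
    (hdecay : ∀ k : ℕ, H ({y | ENNReal.ofReal (2 ^ k * s) < g y} ∩ B) ≤
      ENNReal.ofReal (((2 ^ q) ^ k)⁻¹ * m)) :
    choquetIntegral (fun S => H (S ∩ B)) g ≤ ENNReal.ofReal (layerConst q * (s * m)) := by
  have hb := two_rpow_one_sub_lt_one hq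
  have hb0 : 0 < (2 : ℝ) ^ (1 - q) := by positivity
  have hsplit : Ioi (0 : ℝ) = Ioc 0 s ∪ Ioi s := (Ioc_union_Ioi_eq_Ioi hs.le).symm
  have h1 : ∫⁻ t in Ioc 0 s, H ({y | ENNReal.ofReal t < g y} ∩ B) ≤ ENNReal.ofReal (s * m) := by
    calc _ ≤ ∫⁻ _ in Ioc 0 s, ENNReal.ofReal m :=
          setLIntegral_mono' measurableSet_Ioc fun t _ => (H.mono inter_subset_right).trans hB
      _ = ENNReal.ofReal (s * m) := by
          rw [setLIntegral_const, Real.volume_Ioc, sub_zero, mul_comm, ENNReal.ofReal_mul hs.le]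
  have h2 : ∫⁻ t in Ioi s, H ({y | ENNReal.ofReal t < g y} ∩ B) ≤
      ENNReal.ofReal (s * m * (1 - 2 ^ (1 - q))⁻¹) := by
    refine ((antitone_outerMeasure_superlevel_inter H g B).lintegral_Ioi_le_tsum hs).trans ?_
    rw [← ENNReal.tsum_ofReal_mul_geometric (by positivity) hb0.le hb]
    refine ENNReal.tsum_le_tsum fun k => ?_
    refine (mul_le_mul_right (hdecay k) _).trans (le_of_eq ?_)
    rw [← ENNReal.ofReal_mul (by positivity), Real.rpow_sub two_pos, Real.rpow_one, div_pow]
    congr 1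
    field_simp
  unfold choquetIntegral
  rw [hsplit]
  refine (lintegral_union_le _ _ _).trans ((add_le_add h1 h2).trans (le_of_eq ?_))
  have h3 : 0 < (1 - (2 : ℝ) ^ (1 - q))⁻¹ := inv_pos.2 (by linarith)
  rw [← ENNReal.ofReal_add (by positivity) (by positivity), layerConst]
  congr 1; ring

/-! ### Means over balls -/

/-- The good-`λ` form of the maximal inequality: the points around which the mean of `g` exceeds a
multiple of `s` at some scale are controlled by the superlevel sets of `g` beyond `s`. -/
theorem hausdorffContent_setOf_lt_choquetIntegral_le {n : ℕ} {δ : ℝ} (hδ : 0 < δ)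
    (g : EuclideanSpace ℝ (Fin n) → ℝ≥0∞) {q s : ℝ} (hq : 1 < q) (hs : 0 < s) :
    hausdorffContent δ {x | ∃ r : ℝ, 0 < r ∧ ENNReal.ofReal (layerConst q * (s * r ^ δ)) <
        choquetIntegral (fun S => hausdorffContent δ (S ∩ Metric.ball x r)) g} ≤
      ∑' k : ℕ, ENNReal.ofReal (2 * 11 ^ δ * (2 ^ q) ^ k) *
        hausdorffContent δ {y | ENNReal.ofReal (2 ^ k * s) < g y} := by
  have hb : (1 : ℝ) ≤ 2 ^ q := Real.one_le_rpow one_le_two (by linarith)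
  refine (hausdorffContent_mono (F := ⋃ k : ℕ, {x | ∃ r : ℝ, 0 < r ∧
      ENNReal.ofReal (((2 ^ q) ^ k)⁻¹ * r ^ δ) <
        hausdorffContent δ ({y | ENNReal.ofReal (2 ^ k * s) < g y} ∩ Metric.ball x r)})
      ?_).trans ((hausdorffContent_iUnion_le _).trans (ENNReal.tsum_le_tsum fun k => ?_))
  · rintro x ⟨r, hr, hlt⟩
    by_contra hcon
    simp only [mem_iUnion, mem_ofPred_eq, not_exists, not_and, not_lt] at hcon
    exact hlt.not_ge (choquetIntegral_inter_le_of_decay (hausdorffContentOuter n hδ) g hq hs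
      (by positivity) (hausdorffContent_ball_le hδ x hr.le) fun k => hcon k r hr)
  · refine (hausdorffContent_setOf_lt_inter_ball_le hδ _ (by positivity)
      (inv_le_one_of_one_le₀ (one_le_pow₀ hb))).trans (le_of_eq ?_)
    rw [div_inv_eq_mul]

/-- Hölder's inequality over a ball. -/
theorem choquetIntegral_inter_ball_le {n : ℕ} {δ : ℝ} (hδ : 0 < δ)
    {g : EuclideanSpace ℝ (Fin n) → ℝ≥0∞} {p A r : ℝ} (hp : 1 < p) (hA : 0 < A) (hr : 0 < r)
    (hgA : choquetIntegral (hausdorffContent δ) (fun y => g y ^ p) ≤ ENNReal.ofReal (A ^ p))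
    (x : EuclideanSpace ℝ (Fin n)) :
    choquetIntegral (fun S => hausdorffContent δ (S ∩ Metric.ball x r)) g ≤
      ENNReal.ofReal (layerConst p * (A * r ^ (δ - δ / p))) := by
  have hp0 : 0 < p := by linarith
  -- The level at which the bounds `r ^ δ` and `A ^ p / s ^ p` of the superlevel sets agree.
  set s := A * r ^ (-(δ / p)) with hs_def
  have hs : 0 < s := by positivity
  have h1 : s * r ^ δ = A * r ^ (δ - δ / p) := by
    rw [hs_def, mul_assoc, ← Real.rpow_add hr]; ring_nf
  have h2 : s ^ p = A ^ p * (r ^ δ)⁻¹ := by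
    rw [hs_def, Real.mul_rpow hA.le (by positivity), ← Real.rpow_mul hr.le, ← Real.rpow_neg hr.le]
    congr 2; field_simp
  rw [← h1]
  refine choquetIntegral_inter_le_of_decay (hausdorffContentOuter n hδ) g hp hs
      (by positivity) (hausdorffContent_ball_le hδ x hr.le) fun k => ?_
  refine ((hausdorffContentOuter n hδ).mono inter_subset_left).trans
    ((outerMeasure_superlevel_le_of_choquetIntegral_rpow_le (hausdorffContentOuter n hδ) hp0
      (by positivity) hgA).trans (le_of_eq ?_))
  rw [Real.mul_rpow (by positivity) hs.le, h2, Real.rpow_pow_comm two_pos.le]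
  congr 1
  field_simp

/-! ### The Riesz potential -/

/-- Decomposition of a Riesz type potential into dyadic annuli. -/
theorem choquetIntegral_div_rpow_le_tsum {n : ℕ} {δ : ℝ} (hδ : 0 < δ)
    (g : EuclideanSpace ℝ (Fin n) → ℝ≥0∞) (x : EuclideanSpace ℝ (Fin n)) {β ρ : ℝ} (hβ : 0 < β)
    (hρ : 0 < ρ) :
    choquetIntegral (hausdorffContent δ) (fun y => g y / ‖x - y‖ₑ ^ β) ≤
      ∑' k : ℤ, ENNReal.ofReal ((2 ^ k * ρ) ^ β)⁻¹ *
        choquetIntegral (fun S => hausdorffContent δ (S ∩ Metric.ball x (2 ^ (k + 1) * ρ))) g := by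
  set H := hausdorffContentOuter n hδ
  have hpos (k : ℤ) : 0 < (2 ^ k * ρ) ^ β := by positivity
  calc choquetIntegral (hausdorffContent δ) (fun y => g y / ‖x - y‖ₑ ^ β)
      ≤ ∫⁻ t in Ioi (0 : ℝ), ∑' k : ℤ,
          H ({y | ENNReal.ofReal ((2 ^ k * ρ) ^ β * t) < g y} ∩
            Metric.ball x (2 ^ (k + 1) * ρ)) := by
        refine setLIntegral_mono' measurableSet_Ioi fun t _ => ?_
        have hsub : {y | ENNReal.ofReal t < g y / ‖x - y‖ₑ ^ β} ⊆ {x} ∪ ⋃ k : ℤ,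
            ({y | ENNReal.ofReal ((2 ^ k * ρ) ^ β * t) < g y} ∩
              Metric.ball x (2 ^ (k + 1) * ρ)) := fun y hy => by
          rcases eq_or_ne y x with rfl | hyx
          · exact Or.inl rfl
          have hd : 0 < ‖x - y‖ := norm_pos_iff.2 (sub_ne_zero.2 hyx.symm)
          obtain ⟨k, hk1, hk2⟩ := exists_mem_Ico_zpow (div_pos hd hρ) one_lt_two
          rw [le_div_iff₀ hρ] at hk1
          rw [div_lt_iff₀ hρ] at hk2
          refine Or.inr (mem_iUnion.2 ⟨k, ?_, ?_⟩)
          · rw [mem_ofPred_eq, ← ofReal_norm, ENNReal.ofReal_rpow_of_pos hd,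
              ENNReal.lt_div_iff_mul_lt (Or.inl (by simp; positivity)) (Or.inl (by simp))] at hy
            refine lt_of_le_of_lt ?_ hy
            rw [ENNReal.ofReal_mul (hpos k).le, mul_comm]
            gcongr
          · rwa [Metric.mem_ball, dist_comm, dist_eq_norm]
        refine (measure_mono (μ := H) hsub).trans ((measure_union_le _ _).trans ?_)
        rw [show H {x} = 0 from hausdorffContent_singleton hδ x, zero_add]
        exact measure_iUnion_le _
    _ = ∑' k : ℤ, ∫⁻ t in Ioi (0 : ℝ),
          H ({y | ENNReal.ofReal ((2 ^ k * ρ) ^ β * t) < g y} ∩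
            Metric.ball x (2 ^ (k + 1) * ρ)) := by
        refine lintegral_tsum fun k => Measurable.aemeasurable (Antitone.measurable ?_)
        exact fun a b hab => antitone_outerMeasure_superlevel_inter H g _
          (mul_le_mul_of_nonneg_left hab (hpos k).le)
    _ = _ := by
        congr 1 with k
        exact lintegral_Ioi_comp_mul_left
          (fun t => H ({y | ENNReal.ofReal t < g y} ∩ Metric.ball x (2 ^ (k + 1) * ρ))) (hpos k)

/-- Hedberg's estimate. Away from the points where some mean of `g` is large, the part of the
potential within distance `ρ` is bounded through the means of `g`, the rest through the size `A`
of `g`. -/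
theorem exists_choquetIntegral_div_rpow_le {n : ℕ} {δ α p q : ℝ} (hα : 0 < α) (hαδ : α < δ)
    (hp : 1 < p) (hpα : α < δ / p) (hq : 1 < q) :
    ∃ K : ℝ, 0 < K ∧ ∀ (g : EuclideanSpace ℝ (Fin n) → ℝ≥0∞) (A s ρ : ℝ), 0 < A → 0 < s → 0 < ρ →
      choquetIntegral (hausdorffContent δ) (fun y => g y ^ p) ≤ ENNReal.ofReal (A ^ p) →
      ∀ x, (∀ r : ℝ, 0 < r →
        choquetIntegral (fun S => hausdorffContent δ (S ∩ Metric.ball x r)) g ≤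
          ENNReal.ofReal (layerConst q * (s * r ^ δ))) →
      choquetIntegral (hausdorffContent δ) (fun y => g y / ‖x - y‖ₑ ^ (δ - α)) ≤
        ENNReal.ofReal (K * (s * ρ ^ α + A * ρ ^ (α - δ / p))) := by
  have hδ : 0 < δ := hα.trans hαδ
  have hLq := layerConst_pos hq
  have hLp := layerConst_pos hp
  have hb1 : (2 : ℝ) ^ (-α) < 1 := Real.rpow_lt_one_of_one_lt_of_neg one_lt_two (by linarith)
  have hb2 : (2 : ℝ) ^ (α - δ / p) < 1 :=
    Real.rpow_lt_one_of_one_lt_of_neg one_lt_two (by linarith)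
  have hi1 : 0 < (1 - (2 : ℝ) ^ (-α))⁻¹ := inv_pos.2 (by linarith)
  have hi2 : 0 < (1 - (2 : ℝ) ^ (α - δ / p))⁻¹ := inv_pos.2 (by linarith)
  set N := layerConst q * 2 ^ (δ - α) * (1 - (2 : ℝ) ^ (-α))⁻¹ with hN
  set R := layerConst p * 2 ^ (δ - δ / p) * (1 - (2 : ℝ) ^ (α - δ / p))⁻¹ with hR
  have hN0 : 0 < N := by positivity
  have hR0 : 0 < R := by positivity
  refine ⟨N + R, by positivity, fun g A s ρ hA hs hρ hgA x hgood => ?_⟩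
  refine (choquetIntegral_div_rpow_le_tsum hδ g x (sub_pos.2 hαδ) hρ).trans ?_
  rw [tsum_of_nat_of_neg_add_one ENNReal.summable ENNReal.summable]
  have hfar : ∑' j : ℕ, ENNReal.ofReal ((2 ^ (j : ℤ) * ρ) ^ (δ - α))⁻¹ *
      choquetIntegral (fun S => hausdorffContent δ
        (S ∩ Metric.ball x (2 ^ ((j : ℤ) + 1) * ρ))) g ≤
      ENNReal.ofReal (R * (A * ρ ^ (α - δ / p))) := by
    rw [show R * (A * ρ ^ (α - δ / p)) = layerConst p * 2 ^ (δ - δ / p) * (A * ρ ^ (α - δ / p)) *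
      (1 - (2 : ℝ) ^ (α - δ / p))⁻¹ by rw [hR]; ring,
      ← ENNReal.tsum_ofReal_mul_geometric (by positivity) (by positivity) hb2]
    refine ENNReal.tsum_le_tsum fun j => ?_
    refine (mul_le_mul_right (choquetIntegral_inter_ball_le hδ hp hA (by positivity) hgA x)
      _).trans (le_of_eq ?_)
    rw [← ENNReal.ofReal_mul (by positivity), Real.rpow_pow_comm two_pos.le,
      zpow_add₀ two_ne_zero, zpow_natCast, zpow_one]
    have hb : (0 : ℝ) < 2 ^ j := by positivity
    generalize (2 : ℝ) ^ j = b at hb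
    congr 1
    rw [Real.mul_rpow (by positivity) hρ.le, Real.mul_rpow (by positivity) hρ.le,
      Real.mul_rpow hb.le two_pos.le]
    simp only [Real.rpow_sub hb, Real.rpow_sub hρ]
    field_simp
  have hnear : ∑' j : ℕ, ENNReal.ofReal ((2 ^ (-((j : ℤ) + 1)) * ρ) ^ (δ - α))⁻¹ *
      choquetIntegral (fun S => hausdorffContent δ
        (S ∩ Metric.ball x (2 ^ (-((j : ℤ) + 1) + 1) * ρ))) g ≤
      ENNReal.ofReal (N * (s * ρ ^ α)) := by
    rw [show N * (s * ρ ^ α) = layerConst q * 2 ^ (δ - α) * (s * ρ ^ α) *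
      (1 - (2 : ℝ) ^ (-α))⁻¹ by rw [hN]; ring,
      ← ENNReal.tsum_ofReal_mul_geometric (by positivity) (by positivity) hb1]
    refine ENNReal.tsum_le_tsum fun j => ?_
    refine (mul_le_mul_right (hgood _ (by positivity)) _).trans (le_of_eq ?_)
    rw [← ENNReal.ofReal_mul (by positivity), Real.rpow_pow_comm two_pos.le,
      show -((j : ℤ) + 1) + 1 = -j by ring, zpow_neg, zpow_neg,
      zpow_add₀ two_ne_zero, zpow_natCast, zpow_one]
    have hb : (0 : ℝ) < 2 ^ j := by positivity
    generalize (2 : ℝ) ^ j = b at hb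
    congr 1
    rw [Real.mul_rpow (by positivity) hρ.le, Real.mul_rpow (by positivity) hρ.le,
      Real.inv_rpow (by positivity), Real.inv_rpow hb.le, Real.mul_rpow hb.le two_pos.le]
    simp only [Real.rpow_sub hb, Real.rpow_sub hρ, Real.rpow_neg hb.le]
    field_simp
  refine (add_le_add hfar hnear).trans ?_
  rw [← ENNReal.ofReal_add (by positivity) (by positivity)]
  refine ENNReal.ofReal_le_ofReal ?_
  have h1 : 0 < s * ρ ^ α := by positivity
  have h2 : 0 < A * ρ ^ (α - δ / p) := by positivity
  nlinarith

/-- The potential estimate for functions of size at most `A`. -/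
theorem exists_choquetIntegral_potential_rpow_le (n : ℕ) {δ α p : ℝ} (hα : 0 < α) (hαδ : α < δ)
    (hp : 1 < p) (hpα : p * α < δ) :
    ∃ c : ℝ, 0 < c ∧ ∀ (g : EuclideanSpace ℝ (Fin n) → ℝ≥0∞) (A : ℝ), 0 < A →
      choquetIntegral (hausdorffContent δ) (fun y => g y ^ p) ≤ ENNReal.ofReal (A ^ p) →
      choquetIntegral (hausdorffContent δ) (fun x => choquetIntegral (hausdorffContent δ)
          (fun y => g y / ‖x - y‖ₑ ^ (δ - α)) ^ (δ * p / (δ - p * α))) ≤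
        ENNReal.ofReal (c * A ^ (δ * p / (δ - p * α))) := by
  have hδ : 0 < δ := hα.trans hαδ
  have hp0 : 0 < p := by linarith
  have hd : 0 < δ - p * α := by linarith
  -- `1 < q` makes the layers of a single mean summable, `q < p` the contributions of all levels.
  obtain ⟨q, hq, hqp⟩ := exists_between hp
  obtain ⟨K, hK, hhed⟩ := exists_choquetIntegral_div_rpow_le (n := n) hα hαδ hp
    (by rw [lt_div_iff₀ hp0]; linarith) hq
  set Q := δ * p / (δ - p * α) with hQ
  have hQ0 : 0 < Q := by positivity
  have hb : (2 : ℝ) ^ (q - p) < 1 := Real.rpow_lt_one_of_one_lt_of_neg one_lt_two (by linarith)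
  have hi : 0 < (1 - (2 : ℝ) ^ (q - p))⁻¹ := inv_pos.2 (by linarith)
  refine ⟨2 * 11 ^ δ * (2 * K) ^ Q * (1 - (2 : ℝ) ^ (q - p))⁻¹, by positivity,
    fun g A hA hgA => ?_⟩
  set H := hausdorffContentOuter n hδ
  set c : ℕ → ℝ := fun k => (2 ^ p) ^ k * A ^ (p - Q) * ((2 * K) ^ Q)⁻¹ with hc
  have hc0 (k : ℕ) : 0 < c k := by positivity
  -- The distribution function of the potential is controlled by that of `g ^ p`.
  have hdist : ∀ t ∈ Ioi (0 : ℝ), hausdorffContent δ {x | ENNReal.ofReal t <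
      choquetIntegral (hausdorffContent δ) (fun y => g y / ‖x - y‖ₑ ^ (δ - α)) ^ Q} ≤
      ∑' k : ℕ, ENNReal.ofReal (2 * 11 ^ δ * (2 ^ q) ^ k) *
        H {y | ENNReal.ofReal (c k * t) < g y ^ p} := fun t ht => by
    rw [mem_Ioi] at ht
    set τ := t ^ Q⁻¹ / (2 * K) with hτ_def
    have hτ : 0 < τ := by positivity
    have hτQ : τ ^ Q = t * ((2 * K) ^ Q)⁻¹ := by
      rw [hτ_def, Real.div_rpow (by positivity) (by positivity), ← Real.rpow_mul ht.le,
        inv_mul_cancel₀ hQ0.ne', Real.rpow_one, div_eq_mul_inv]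
    -- The radius `ρ` and the level `s` make both terms of Hedberg's estimate equal to `τ`.
    set ρ := (A / τ) ^ (p / (δ - p * α)) with hρ_def
    have hρ : 0 < ρ := by positivity
    set s := τ * ρ ^ (-α) with hs_def
    have hs : 0 < s := by positivity
    have e1 : s * ρ ^ α = τ := by
      rw [hs_def, mul_assoc, ← Real.rpow_add hρ]; simp
    have e2 : A * ρ ^ (α - δ / p) = τ := by
      rw [hρ_def, ← Real.rpow_mul (by positivity),
        show p / (δ - p * α) * (α - δ / p) = -1 by field_simp; ring, Real.rpow_neg_one]
      field_simp
    have e3 : s ^ p = A ^ (p - Q) * τ ^ Q := by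
      rw [hs_def, Real.mul_rpow hτ.le (by positivity), hρ_def, ← Real.rpow_mul (by positivity),
        ← Real.rpow_mul (by positivity),
        show p / (δ - p * α) * (-α * p) = p - Q by rw [hQ]; field_simp; ring,
        Real.div_rpow hA.le hτ.le, Real.rpow_sub hτ]
      field_simp
    refine (hausdorffContent_mono ?_).trans
      ((hausdorffContent_setOf_lt_choquetIntegral_le hδ g hq hs).trans
        (ENNReal.tsum_le_tsum fun k => mul_le_mul_right (H.mono ?_) _))
    · intro x hx
      by_contra hcon
      simp only [mem_ofPred_eq, not_exists, not_and, not_lt] at hcon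
      have h := ENNReal.rpow_le_rpow (hhed g A s ρ hA hs hρ hgA x hcon) hQ0.le
      rw [e1, e2, ENNReal.ofReal_rpow_of_nonneg (by positivity) hQ0.le,
        show (K * (τ + τ)) = 2 * K * τ by ring, Real.mul_rpow (by positivity) hτ.le, hτQ] at h
      refine (lt_of_lt_of_le hx h).ne ?_
      congr 1
      field_simp
    · intro y hy
      have h := ENNReal.rpow_lt_rpow hy hp0
      rw [ENNReal.ofReal_rpow_of_nonneg (by positivity) hp0.le,
        Real.mul_rpow (by positivity) hs.le, e3, hτQ] at h
      refine lt_of_eq_of_lt ?_ h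
      simp only [hc, Real.rpow_pow_comm two_pos.le]
      congr 1
      ring
  calc choquetIntegral (hausdorffContent δ) (fun x => choquetIntegral (hausdorffContent δ)
          (fun y => g y / ‖x - y‖ₑ ^ (δ - α)) ^ Q)
      ≤ ∫⁻ t in Ioi (0 : ℝ), ∑' k : ℕ, ENNReal.ofReal (2 * 11 ^ δ * (2 ^ q) ^ k) *
        H {y | ENNReal.ofReal (c k * t) < g y ^ p} := setLIntegral_mono' measurableSet_Ioi hdist
    _ = ∑' k : ℕ, ENNReal.ofReal (2 * 11 ^ δ * (2 ^ q) ^ k) *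
          (ENNReal.ofReal (c k)⁻¹ * choquetIntegral (hausdorffContent δ) (fun y => g y ^ p)) := by
        have hmeas (k : ℕ) :
            Measurable fun t => H {y | ENNReal.ofReal (c k * t) < g y ^ p} :=
          Antitone.measurable fun a b hab => antitone_outerMeasure_superlevel H _
            (mul_le_mul_of_nonneg_left hab (hc0 k).le)
        rw [lintegral_tsum fun k => ((hmeas k).const_mul _).aemeasurable]
        congr 1 with k
        rw [lintegral_const_mul _ (hmeas k), lintegral_Ioi_comp_mul_left
          (fun t => H {y | ENNReal.ofReal t < g y ^ p}) (hc0 k)]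
        rfl
    _ ≤ ∑' k : ℕ, ENNReal.ofReal (2 * 11 ^ δ * (2 * K) ^ Q * A ^ Q * (2 ^ (q - p)) ^ k) := by
        refine ENNReal.tsum_le_tsum fun k =>
          (mul_le_mul_right (mul_le_mul_right hgA _) _).trans (le_of_eq ?_)
        have := hc0 k
        rw [← ENNReal.ofReal_mul (by positivity), ← ENNReal.ofReal_mul (by positivity)]
        congr 1
        simp only [hc, Real.rpow_sub two_pos, Real.rpow_sub hA, div_pow]
        field_simp
    _ = ENNReal.ofReal (2 * 11 ^ δ * (2 * K) ^ Q * (1 - (2 : ℝ) ^ (q - p))⁻¹ * A ^ Q) := by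
        rw [ENNReal.tsum_ofReal_mul_geometric (by positivity) (by positivity) hb]
        congr 1
        ring

theorem mainTheorem3 (n : ℕ) (hn : 1 ≤ n) (δ α p : ℝ)
    (hδ : δ ∈ Ioo (0 : ℝ) n) (hα : α ∈ Ioo 0 δ) (hp : p ∈ Ioo 1 (δ / α)) :
    ∃ c : ℝ≥0, ∀ f : EuclideanSpace ℝ (Fin n) → EReal,
      NullMeasurable f (volume : Measure (EuclideanSpace ℝ (Fin n))) →
        (choquetIntegral (hausdorffContent δ)
            (fun x => hausdorffRieszPotential δ α f x ^ (δ * p / (δ - p * α)))) ^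
              ((δ - p * α) / (δ * p))
          ≤ (c : ℝ≥0∞) *
            (choquetIntegral (hausdorffContent δ) (fun x => (f x).abs ^ p)) ^ (1 / p) := by
  obtain ⟨hα0, hαδ⟩ := hα
  obtain ⟨hp1, hp2⟩ := hp
  have hp0 : 0 < p := by linarith
  have hδ0 : 0 < δ := hδ.1
  rw [lt_div_iff₀ hα0] at hp2
  have hd : 0 < δ - p * α := by linarith
  have hQ : (δ - p * α) / (δ * p) = (δ * p / (δ - p * α))⁻¹ := (inv_div _ _).symm
  have hQ0 : 0 < δ * p / (δ - p * α) := by positivity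
  obtain ⟨c, hc, hmain⟩ := exists_choquetIntegral_potential_rpow_le n hα0 hαδ hp1 hp2
  rw [hQ]
  set Q := δ * p / (δ - p * α)
  have hcQ : 0 < c ^ Q⁻¹ := Real.rpow_pos_of_pos hc _
  refine ⟨(c ^ Q⁻¹).toNNReal, fun f _ => ?_⟩
  rw [mul_comm, ← ENNReal.div_le_iff_le_mul (by simp [hcQ]) (by simp)]
  refine le_of_forall_gt_imp_ge_of_dense fun a ha => ?_
  rcases eq_or_ne a ∞ with rfl | hatop
  · exact le_top
  lift a to ℝ≥0 using hatop
  have ha0 : (0 : ℝ) < a := by exact_mod_cast zero_le.trans_lt ha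
  rw [ENNReal.div_le_iff_le_mul (by simp [hcQ]) (by simp), mul_comm]
  have hfa : choquetIntegral (hausdorffContent δ) (fun x => (f x).abs ^ p) ≤
      ENNReal.ofReal ((a : ℝ) ^ p) := by
    rw [← ENNReal.ofReal_rpow_of_nonneg a.coe_nonneg hp0.le, ENNReal.ofReal_coe_nnreal]
    rw [one_div, ENNReal.rpow_inv_lt_iff hp0] at ha
    exact ha.le
  have h := ENNReal.rpow_le_rpow (hmain _ a ha0 hfa) (inv_pos.2 hQ0).le
  refine h.trans (le_of_eq ?_)
  rw [ENNReal.ofReal_rpow_of_nonneg (by positivity) (by positivity),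
    Real.mul_rpow hc.le (by positivity), ← Real.rpow_mul a.coe_nonneg, mul_inv_cancel₀ hQ0.ne',
    Real.rpow_one, ENNReal.ofReal_mul hcQ.le, ENNReal.ofReal_coe_nnreal]
  rfl
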